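/- Let $K$ be an infinite field, let $d\ge 2$ and $k\ge 1$ be integers, and let $$T=(1,2,\ldots,d-1,\underbrace{d,\ldots,d}_{k},d-1,\ldots,2,1)$$ (indexed by the degrees $0,1,\ldots,j$ with $j=2d+k-3$, and continued by $0$). Assume that $\operatorname{char}K$ is $0$ or greater than $j$. Let $P=(p_1^{n_1},\ldots,p_t^{n_t})$, with $p_1>\cdots>p_t\geq 1$ and all $n_i\ge 1$, be a partition of diagonal lengths $T$; that is, for each $i\ge 0$ the number of boxes of the Ferrers diagram of $P$ in row $r$ and column $c$ (both counted from $0$) with $r+c=i$ is $T_i$. Then the following are equivalent: (a) $P$ is a complete intersection Jordan type for $T$: there are a graded Artinian complete intersection $A=K[x,y]/I$ (that is, $I$ is generated by two forms of positive degree and $\dim_K A<\infty$) with Hilbert function $\dim_K A_i=T_i$ for all $i$, and a linear form $\ell$, such that $P$ is the partition given by the sizes of the Jordan blocks of the nilpotent map $A\to A$, $a\mapsto \ell a$; (b) $p_{i-1}=n_{i-1}+n_i+p_i$ for every $i\in[2,t]$. -/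

import Mathlib

namespace CIJordan

/-- The length of the `i`-th diagonal (cells in row `r` and column `c` with `r + c = i`, both
counted from `0`) of the Ferrers diagram of a partition. -/
def diagonalLength (P : YoungDiagram) (i : ℕ) : ℕ :=
  (P.cells.filter fun c => c.1 + c.2 = i).card

/-- The sequence `T(d, k) = (1, 2, …, d - 1, d, …, d, d - 1, …, 2, 1, 0, 0, …)`, in which the
height `d` occurs `k` times, in degrees `d - 1, …, d + k - 2`; the last nonzero entry is in degree
`2 * d + k - 3`. The subtraction is truncated, which gives the zeros at the end. -/
def ciSequence (d k i : ℕ) : ℕ :=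
  min (min (i + 1) d) (2 * d + k - (i + 2))

section Algebra

variable {K : Type*} [Field K]

/-- `P` is the Jordan type of the (nilpotent) endomorphism `φ`: there is a basis made of strings,
one for each row of the Ferrers diagram of `P`; the string of a row has the length of that row,
`φ` moves each basis vector to the next one of its string, and sends the last one to `0`. -/
def HasJordanType {V : Type*} [AddCommGroup V] [Module K V] (φ : V →ₗ[K] V)
    (P : YoungDiagram) : Prop :=
  ∃ b : Module.Basis {c : ℕ × ℕ // c ∈ P} K V,
    ∀ (r c : ℕ) (h : (r, c) ∈ P),
      φ (b ⟨(r, c), h⟩) = if h' : (r, c + 1) ∈ P then b ⟨(r, c + 1), h'⟩ else 0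

/-- The Hilbert function of the standard graded algebra `K[x, y] / I` (for a homogeneous ideal `I`):
the dimension of the image of the space of forms of degree `i`. -/
noncomputable def hilbertFunction (I : Ideal (MvPolynomial (Fin 2) K)) (i : ℕ) : ℕ :=
  Module.finrank K
    ((MvPolynomial.homogeneousSubmodule (Fin 2) K i).map (Ideal.Quotient.mkₐ K I).toLinearMap)

/-- `K[x, y] / I` is a graded Artinian complete intersection: it has finite dimension over `K`, and
`I` is generated by two forms of positive degree (as many as the height of `I`). -/
def IsGradedArtinianCI (I : Ideal (MvPolynomial (Fin 2) K)) : Prop :=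
  Module.Finite K (MvPolynomial (Fin 2) K ⧸ I) ∧
    ∃ (f g : MvPolynomial (Fin 2) K) (a b : ℕ), 0 < a ∧ 0 < b ∧
      f.IsHomogeneous a ∧ g.IsHomogeneous b ∧ I = Ideal.span {f, g}

end Algebra

/-- `P` occurs as the Jordan type of multiplication by a linear form `ℓ` on a graded Artinian
complete intersection quotient `A = K[x, y] / I` with Hilbert function `H(A) = T`. -/
def IsCIJordanType (K : Type*) [Field K] (T : ℕ → ℕ) (P : YoungDiagram) : Prop :=
  ∃ (I : Ideal (MvPolynomial (Fin 2) K)) (ℓ : MvPolynomial (Fin 2) K),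
    IsGradedArtinianCI I ∧ (∀ i, hilbertFunction I i = T i) ∧ ℓ.IsHomogeneous 1 ∧
      HasJordanType (LinearMap.mulLeft K (Ideal.Quotient.mk I ℓ)) P

/-- `P = (p_1^{n_1}, …, p_t^{n_t})` with `p_1 > ⋯ > p_t` and all `n_i ≥ 1` (the indices are shifted
by one: they start at `0`). Every partition has exactly one such power form. -/
def IsPowerForm (P : YoungDiagram) {t : ℕ} (p n : Fin t → ℕ) : Prop :=
  StrictAnti p ∧ (∀ i, 0 < n i) ∧
    P.rowLens = (List.ofFn fun i => List.replicate (n i) (p i)).flatten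

end CIJordan

/-! Write `R = K[x, y]`, and let `s i` be the sum of the first `i` multiplicities, with indices
starting at `0`.

(a) implies (b). A linear change of coordinates makes the linear form equal to `x`. The column
length `N c` of `P` is then the dimension of `R / ((I : x ^ c) + (x))`. Each colon ideal `I : x ^ c`
with `N (c - 1) > 0` or `c = 0` has the form `(F, x G)`, where `F` is not divisible by `x`; its
degree is `N c`, and `I : x ^ (c + 1) = (F, G)`. A Euclidean step restores the shape
(`IsColumnState.step`). Either `G` becomes divisible by `x` modulo `F`, and then `N` is unchanged
while `e = deg G` falls by one; or `G` takes over the role of `F`, and then `N` falls to `e` while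
the new `e` is the old `N` minus one. Between the drops at `p (i + 1)` and `p i`, the value `e` thus
runs down from `s (i + 2) - 1` to `s i`, one unit per column. Hence `p i - p (i + 1) = s (i + 2) - s
i = n i + n (i + 1)` (`IsColumnState.parts_eq`).

(b) implies (a). Condition (b) makes the polynomials `continuant` homogeneous, of degrees `s i`.
Filling the gaps with powers of `y` gives forms `u r`, one in each degree, equal to `y ^ r` modulo
`x`, so the `x ^ c * u r` are a basis of `R`. The recursion shows that those with `(r, c)` outside
`P` span an ideal with two generators (`HasBlocks.mul_mem_span`, `X_pow_mul_continuant_mem`). The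
others give a basis of the quotient, on which `x` moves along the rows of `P` and the degree is
constant along diagonals. -/

namespace CIJordan

open MvPolynomial

/-! ### Binary forms and restriction to `x = 0`. -/

section Polynomials

variable {K : Type*} [Field K]

/-- Evaluation at `x = 0` on `K[x, y]`. -/
noncomputable def evalZero (K : Type*) [Field K] : MvPolynomial (Fin 2) K →ₐ[K] Polynomial K :=
  aeval ![0, Polynomial.X]

@[simp] lemma evalZero_X_zero : evalZero K (X 0) = 0 := by simp [evalZero]

@[simp] lemma evalZero_X_one : evalZero K (X 1) = Polynomial.X := by simp [evalZero]

@[simp] lemma evalZero_C (a : K) : evalZero K (C a) = Polynomial.C a := by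
  simp [evalZero]

lemma evalZero_aeval (f : Polynomial K) :
    evalZero K (Polynomial.aeval (X 1) f) = f := by
  have : (evalZero K).comp (Polynomial.aeval (X 1)) = AlgHom.id K (Polynomial K) := by
    ext; simp
  exact DFunLike.congr_fun this f

lemma evalZero_surjective : Function.Surjective (evalZero K) :=
  fun f => ⟨_, evalZero_aeval f⟩

/-- Restricting to `x = 0` and reading the result back in `K[x, y]` changes nothing modulo `x`; it
suffices to check this on the variables. -/
lemma evalZero_eq_zero_iff (u : MvPolynomial (Fin 2) K) :
    evalZero K u = 0 ↔ ∃ v, u = X 0 * v := by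
  constructor
  · intro h
    have key : (Ideal.Quotient.mkₐ K (Ideal.span {(X 0 : MvPolynomial (Fin 2) K)})).comp
        ((Polynomial.aeval (X 1)).comp (evalZero K)) = Ideal.Quotient.mkₐ K _ := by
      ext i
      fin_cases i
      · simp only [Fin.zero_eta, AlgHom.comp_apply, evalZero_X_zero, map_zero]
        symm
        rw [Ideal.Quotient.mkₐ_eq_mk, Ideal.Quotient.eq_zero_iff_mem]
        exact Ideal.mem_span_singleton_self _
      · simp
    have h1 := DFunLike.congr_fun key u
    simp only [AlgHom.comp_apply, h, map_zero] at h1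
    rw [Ideal.Quotient.mkₐ_eq_mk, eq_comm, Ideal.Quotient.eq_zero_iff_mem,
      Ideal.mem_span_singleton] at h1
    exact h1
  · rintro ⟨v, rfl⟩
    simp

lemma eq_C_of_isHomogeneous_zero {F : MvPolynomial (Fin 2) K} (hF : F.IsHomogeneous 0) :
    ∃ a, F = C a :=
  ⟨_, totalDegree_eq_zero_iff_eq_C.1 (Nat.le_zero.1 hF.totalDegree_le)⟩

lemma exists_decomp_of_isHomogeneous {n : ℕ} {F : MvPolynomial (Fin 2) K}
    (hF : F.IsHomogeneous (n + 1)) :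
    ∃ (a : K) (G : MvPolynomial (Fin 2) K), G.IsHomogeneous n ∧
      F = C a * X 1 ^ (n + 1) + X 0 * G := by
  let W : Submodule K (MvPolynomial (Fin 2) K) := Submodule.span K {X 1 ^ (n + 1)} ⊔
    (homogeneousSubmodule (Fin 2) K n).map (LinearMap.mulLeft K (X 0))
  have hW : F ∈ W := by
    rw [F.as_sum]
    refine Submodule.sum_mem _ fun m hm => ?_
    have hdeg : m 0 + m 1 = n + 1 := by
      have := hF (mem_support_iff.1 hm)
      rw [← this, Finsupp.weight_apply, Finsupp.sum_fintype _ _ (by simp)]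
      simp
    have hmon : monomial m (coeff m F) = C (coeff m F) * (X 0 ^ m 0 * X 1 ^ m 1) := by
      rw [monomial_eq, Finsupp.prod_fintype _ _ (by simp)]
      simp
    rw [hmon]
    rcases h0 : m 0 with _ | c
    · refine Submodule.mem_sup_left ?_
      have h1 : m 1 = n + 1 := by omega
      rw [h1, pow_zero, one_mul, ← smul_eq_C_mul]
      exact Submodule.smul_mem _ _ (Submodule.mem_span_singleton_self _)
    · refine Submodule.mem_sup_right ⟨C (coeff m F) * (X 0 ^ c * X 1 ^ m 1), ?_, ?_⟩
      · have h2 : n = 0 + (c + m 1) := by omega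
        rw [SetLike.mem_coe, mem_homogeneousSubmodule, h2]
        exact (isHomogeneous_C _ _).mul ((isHomogeneous_X_pow _ _).mul (isHomogeneous_X_pow _ _))
      · rw [LinearMap.mulLeft_apply]; ring
  obtain ⟨v, hv, w, ⟨G, hG, rfl⟩, rfl⟩ := Submodule.mem_sup.1 hW
  obtain ⟨a, rfl⟩ := Submodule.mem_span_singleton.1 hv
  exact ⟨a, G, hG, by rw [LinearMap.mulLeft_apply, smul_eq_C_mul]⟩

lemma evalZero_of_isHomogeneous {n : ℕ} {F : MvPolynomial (Fin 2) K}
    (hF : F.IsHomogeneous n) : ∃ a, evalZero K F = Polynomial.C a * Polynomial.X ^ n := by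
  cases n with
  | zero =>
    obtain ⟨a, rfl⟩ := eq_C_of_isHomogeneous_zero hF
    exact ⟨a, by simp⟩
  | succ n =>
    obtain ⟨a, G, -, rfl⟩ := exists_decomp_of_isHomogeneous hF
    exact ⟨a, by simp⟩

lemma exists_eq_X_mul_of_isHomogeneous {n : ℕ} {F : MvPolynomial (Fin 2) K}
    (hF : F.IsHomogeneous (n + 1)) (h : evalZero K F = 0) :
    ∃ G : MvPolynomial (Fin 2) K, G.IsHomogeneous n ∧ F = X 0 * G := by
  obtain ⟨a, G, hG, rfl⟩ := exists_decomp_of_isHomogeneous hF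
  have ha : a = 0 := by simpa using h
  exact ⟨G, hG, by simp [ha]⟩

end Polynomials

/-! ### Column lengths of a partition in power form. -/

section PowerForm

/-- Extension of a finite sequence by zero. -/
def extendZero {t : ℕ} (p : Fin t → ℕ) (i : ℕ) : ℕ := if h : i < t then p ⟨i, h⟩ else 0

/-- The partial sums of a sequence. -/
def partialSum (n : ℕ → ℕ) (i : ℕ) : ℕ := ∑ j ∈ Finset.range i, n j

@[simp] lemma partialSum_zero (n : ℕ → ℕ) : partialSum n 0 = 0 := rfl

lemma partialSum_succ (n : ℕ → ℕ) (i : ℕ) : partialSum n (i + 1) = partialSum n i + n i :=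
  Finset.sum_range_succ _ _

lemma partialSum_mono (n : ℕ → ℕ) : Monotone (partialSum n) :=
  monotone_nat_of_le_succ fun i => by rw [partialSum_succ]; omega

/-- Row lengths decrease, so the rows longer than `c` are exactly the first `P.colLen c` ones. -/
lemma colLen_eq_countP (P : YoungDiagram) (c : ℕ) :
    P.colLen c = P.rowLens.countP (fun l => c < l) := by
  have h1 : P.colLen c ≤ P.colLen 0 := P.colLen_anti _ _ (Nat.zero_le _)
  have h2 : ∀ r, c < P.rowLen r ↔ r < P.colLen c := fun r => by
    rw [← YoungDiagram.mem_iff_lt_rowLen, YoungDiagram.mem_iff_lt_colLen]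
  rw [YoungDiagram.rowLens, List.countP_map]
  obtain ⟨m, hm⟩ := Nat.exists_eq_add_of_le h1
  rw [hm, List.range_add, List.countP_append, List.countP_map]
  have e1 : List.countP ((fun l => decide (c < l)) ∘ P.rowLen) (List.range (P.colLen c)) =
      (List.range (P.colLen c)).length := by
    rw [List.countP_eq_length]
    intro r hr
    simpa [h2] using hr
  have e2 : List.countP (((fun l => decide (c < l)) ∘ P.rowLen) ∘ fun x => P.colLen c + x)
      (List.range m) = 0 := by
    rw [List.countP_eq_zero]
    intro r _
    simp [h2]
  rw [e1, e2]
  simp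

variable {P : YoungDiagram} {t : ℕ} {p n : Fin t → ℕ}

lemma IsPowerForm.colLen_eq (hP : IsPowerForm P p n) (c : ℕ) :
    P.colLen c = ∑ i ∈ Finset.range t,
      if c < extendZero p i then extendZero n i else 0 := by
  rw [colLen_eq_countP, hP.2.2, List.countP_flatten, List.map_ofFn, List.sum_ofFn,
    Finset.sum_range]
  refine Finset.sum_congr rfl fun i _ => ?_
  simp only [Function.comp_apply, List.countP_replicate, extendZero, i.2, dif_pos,
    decide_eq_true_eq]

lemma IsPowerForm.pos (hP : IsPowerForm P p n) (i : Fin t) : 0 < p i := by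
  refine P.pos_of_mem_rowLens (p i) ?_
  rw [hP.2.2, List.mem_flatten]
  refine ⟨List.replicate (n i) (p i), List.mem_ofFn.2 ⟨i, rfl⟩, ?_⟩
  exact List.mem_replicate.2 ⟨(hP.2.1 i).ne', rfl⟩

lemma IsPowerForm.extendZero_anti (hP : IsPowerForm P p n) : Antitone (extendZero p) := by
  intro i j hij
  unfold extendZero
  split_ifs with h1 h2
  · exact hP.1.antitone hij
  · omega
  · exact Nat.zero_le _
  · exact le_rfl

lemma IsPowerForm.extendZero_succ_lt (hP : IsPowerForm P p n) {i : ℕ} (hi : i < t) :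
    extendZero p (i + 1) < extendZero p i := by
  unfold extendZero
  rw [dif_pos hi]
  split_ifs with h1
  · exact hP.1 (Fin.mk_lt_mk.2 (Nat.lt_succ_self i))
  · exact hP.pos _

lemma IsPowerForm.colLen_le (hP : IsPowerForm P p n) {i c : ℕ}
    (hc : extendZero p i ≤ c) : P.colLen c ≤ partialSum (extendZero n) i := by
  rw [hP.colLen_eq, ← Finset.sum_filter]
  refine Finset.sum_le_sum_of_subset fun j hj => ?_
  rw [Finset.mem_filter] at hj
  rw [Finset.mem_range]
  by_contra hij
  have := hP.extendZero_anti (not_lt.1 hij)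
  omega

lemma IsPowerForm.le_colLen (hP : IsPowerForm P p n) {i c : ℕ} (hi : i < t)
    (hc : c < extendZero p i) : partialSum (extendZero n) (i + 1) ≤ P.colLen c := by
  rw [hP.colLen_eq, ← Finset.sum_filter]
  refine Finset.sum_le_sum_of_subset fun j hj => ?_
  rw [Finset.mem_range] at hj
  rw [Finset.mem_filter, Finset.mem_range]
  have := hP.extendZero_anti (Nat.le_of_lt_succ hj)
  omega

lemma IsPowerForm.colLen_eq_partialSum (hP : IsPowerForm P p n) {i c : ℕ} (hi : i < t)
    (hc : extendZero p (i + 1) ≤ c) (hc' : c < extendZero p i) :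
    P.colLen c = partialSum (extendZero n) (i + 1) :=
  le_antisymm (hP.colLen_le hc) (hP.le_colLen hi hc')

lemma IsPowerForm.mem_iff (hP : IsPowerForm P p n) {i r c : ℕ} (hi : i < t)
    (hr : partialSum (extendZero n) i ≤ r) (hr' : r < partialSum (extendZero n) (i + 1)) :
    (r, c) ∈ P ↔ c < extendZero p i := by
  rw [YoungDiagram.mem_iff_lt_colLen]
  constructor
  · intro h
    by_contra hc
    have := hP.colLen_le (not_lt.1 hc)
    omega
  · intro h
    have := hP.le_colLen hi h
    omega

lemma IsPowerForm.notMem (hP : IsPowerForm P p n) {r c : ℕ}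
    (hr : partialSum (extendZero n) t ≤ r) : (r, c) ∉ P := by
  rw [YoungDiagram.mem_iff_lt_colLen]
  have := hP.colLen_le (i := t) (c := c) (by simp [extendZero])
  omega

end PowerForm

/-! ### Column lengths as invariants of the nilpotent map. -/

section JordanColumns

variable {K : Type*} [Field K] {V : Type*} [AddCommGroup V] [Module K V]

/-- The rows of length greater than `c` of a Jordan type compute the quotient of `V` by the sum
of the image of `φ` and the kernel of `φ ^ c`. -/
lemma HasJordanType.exists_column_map {φ : V →ₗ[K] V} {P : YoungDiagram}
    (h : HasJordanType φ P) (c : ℕ) :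
    ∃ θ : V →ₗ[K] (Fin (P.colLen c) → K), Function.Surjective θ ∧
      ∀ a, θ a = 0 ↔ ∃ v, (φ ^ c) (a - φ v) = 0 := by
  classical
  obtain ⟨b, hb⟩ := h
  have : Fintype {c : ℕ × ℕ // c ∈ P} := Fintype.subtype P.cells fun _ => Iff.rfl
  have hpow : ∀ (m r s : ℕ) (hrs : (r, s) ∈ P), (φ ^ m) (b ⟨(r, s), hrs⟩) =
      if h' : (r, s + m) ∈ P then b ⟨(r, s + m), h'⟩ else 0 := by
    intro m
    induction m with
    | zero => intro r s hrs; simp [hrs]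
    | succ m ih =>
      intro r s hrs
      rw [pow_succ', Module.End.mul_apply, ih]
      by_cases h1 : (r, s + m) ∈ P
      · rw [dif_pos h1, hb]
        rfl
      · rw [dif_neg h1, map_zero, dif_neg]
        exact fun h2 => h1 (P.up_left_mem le_rfl (by omega) h2)
  have hmem : ∀ r : Fin (P.colLen c), ((r : ℕ), c) ∈ P := fun r =>
    YoungDiagram.mem_iff_lt_colLen.2 r.2
  have hmem0 : ∀ r : Fin (P.colLen c), ((r : ℕ), 0) ∈ P := fun r =>
    P.up_left_mem le_rfl (Nat.zero_le _) (hmem r)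
  let θ : V →ₗ[K] (Fin (P.colLen c) → K) :=
    LinearMap.pi fun r => b.coord ⟨((r : ℕ), 0), hmem0 r⟩
  have hθ : ∀ a r, θ a r = b.repr a ⟨((r : ℕ), 0), hmem0 r⟩ := fun a r => rfl
  refine ⟨θ, ?_, ?_⟩
  · intro w
    refine ⟨∑ r, w r • b ⟨((r : ℕ), 0), hmem0 r⟩, ?_⟩
    ext r
    rw [hθ, map_sum, Finsupp.finsetSum_apply, Finset.sum_eq_single r]
    · simp
    · intro r' _ hne
      rw [map_smul, b.repr_self, Finsupp.smul_apply, Finsupp.single_apply, if_neg, smul_zero]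
      intro heq
      simp only [Subtype.mk.injEq, Prod.mk.injEq, and_true] at heq
      exact hne (Fin.ext heq)
    · simp
  · have h1 : ∀ v, θ (φ v) = 0 := by
      intro v
      have : θ ∘ₗ φ = 0 := by
        refine b.ext ?_
        rintro ⟨⟨r, s⟩, hrs⟩
        ext r'
        rw [LinearMap.comp_apply, hθ, hb]
        split_ifs with h'
        · rw [b.repr_self, Finsupp.single_apply, if_neg (by simp)]
          rfl
        · simp
      exact DFunLike.congr_fun this v
    have h2 : ∀ w, (φ ^ c) w = 0 → θ w = 0 := by
      intro w hw
      ext r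
      -- `φ ^ c` shifts each string by `c`, so the coordinate of `w` at the start of a row is that
      -- of `(φ ^ c) w` at column `c`.
      have : b.coord ⟨((r : ℕ), c), hmem r⟩ ∘ₗ (φ ^ c) = b.coord ⟨((r : ℕ), 0), hmem0 r⟩ := by
        refine b.ext ?_
        rintro ⟨⟨r', s⟩, hrs⟩
        rw [LinearMap.comp_apply, hpow, b.coord_apply, b.coord_apply, b.repr_self,
          Finsupp.single_apply]
        split_ifs with h' h'' h''
        · simp only [Subtype.mk.injEq, Prod.mk.injEq] at h''
          rw [b.repr_self, Finsupp.single_apply, if_pos]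
          simp only [Subtype.mk.injEq, Prod.mk.injEq]
          omega
        · simp only [Subtype.mk.injEq, Prod.mk.injEq] at h''
          rw [b.repr_self, Finsupp.single_apply, if_neg]
          simp only [Subtype.mk.injEq, Prod.mk.injEq]
          omega
        · simp only [Subtype.mk.injEq, Prod.mk.injEq] at h''
          refine absurd (hmem r) ?_
          rw [h''.1, h''.2, zero_add] at h'
          exact h'
        · simp
      have h3 := DFunLike.congr_fun this w
      rw [LinearMap.comp_apply, hw, map_zero, b.coord_apply] at h3
      rw [hθ, ← h3]
      rfl
    intro a
    constructor
    · intro ha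
      -- A basis vector past column `0` is in the image of `φ`; one that starts a row of length at
      -- most `c` is killed by `φ ^ c`. The remaining coordinates vanish by `ha`.
      have hsup : a ∈ LinearMap.range φ ⊔ LinearMap.ker (φ ^ c) := by
        rw [← b.sum_repr a]
        refine Submodule.sum_mem _ ?_
        rintro ⟨⟨r, s⟩, hrs⟩ -
        rcases s with _ | s
        · by_cases hr : r < P.colLen c
          · have := congrFun ha ⟨r, hr⟩
            rw [hθ] at this
            rw [this]
            simp
          · refine Submodule.smul_mem _ _ (Submodule.mem_sup_right ?_)
            rw [LinearMap.mem_ker, hpow, dif_neg]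
            rw [zero_add, YoungDiagram.mem_iff_lt_colLen]
            exact hr
        · refine Submodule.smul_mem _ _ (Submodule.mem_sup_left ?_)
          refine ⟨b ⟨(r, s), P.up_left_mem le_rfl (by omega) hrs⟩, ?_⟩
          rw [hb, dif_pos hrs]
      obtain ⟨_, ⟨v, rfl⟩, w, hw, rfl⟩ := Submodule.mem_sup.1 hsup
      exact ⟨v, by simpa using hw⟩
    · rintro ⟨v, hv⟩
      have := h2 _ hv
      rwa [map_sub, h1, sub_zero] at this

end JordanColumns

/-! ### Colon ideals by powers of `x`. -/

section Columns

variable {K : Type*} [Field K]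

/-- The quotients `R / ((I : ℓ ^ c) + (ℓ))` have the dimensions `N c`. -/
def HasColumns (I : Ideal (MvPolynomial (Fin 2) K)) (ℓ : MvPolynomial (Fin 2) K)
    (N : ℕ → ℕ) : Prop :=
  ∀ c, ∃ θ : MvPolynomial (Fin 2) K →ₗ[K] (Fin (N c) → K), Function.Surjective θ ∧
    ∀ u, θ u = 0 ↔ ∃ v, ℓ ^ c * (u - ℓ * v) ∈ I

lemma hasColumns_of_hasJordanType {I : Ideal (MvPolynomial (Fin 2) K)}
    {ℓ : MvPolynomial (Fin 2) K} {P : YoungDiagram}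
    (h : HasJordanType (LinearMap.mulLeft K (Ideal.Quotient.mk I ℓ)) P) :
    HasColumns I ℓ P.colLen := by
  intro c
  obtain ⟨θ, hs, hk⟩ := h.exists_column_map c
  refine ⟨θ ∘ₗ (Ideal.Quotient.mkₐ K I).toLinearMap,
    hs.comp (Ideal.Quotient.mkₐ_surjective K I), fun u => ?_⟩
  rw [LinearMap.comp_apply, hk, (Ideal.Quotient.mk_surjective (I := I)).exists]
  refine exists_congr fun v => ?_
  rw [LinearMap.pow_mulLeft, ← Ideal.Quotient.eq_zero_iff_mem]
  simp

lemma HasColumns.comap {I : Ideal (MvPolynomial (Fin 2) K)} {ℓ : MvPolynomial (Fin 2) K}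
    {N : ℕ → ℕ} (h : HasColumns I ℓ N)
    (σ : MvPolynomial (Fin 2) K ≃ₐ[K] MvPolynomial (Fin 2) K) :
    HasColumns (I.comap σ) (σ.symm ℓ) N := by
  intro c
  obtain ⟨θ, hs, hk⟩ := h c
  refine ⟨θ ∘ₗ σ.toLinearMap, hs.comp σ.surjective, fun u => ?_⟩
  rw [LinearMap.comp_apply, hk, σ.surjective.exists]
  refine exists_congr fun v => ?_
  rw [Ideal.mem_comap]
  simp

/-- In `x u = a F + b x G`, setting `x = 0` forces `x` to divide `a`, and `x` cancels. This is the
passage from `I : x ^ c` to `I : x ^ (c + 1)`. -/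
lemma mul_X_mem_span_pair_iff {F : MvPolynomial (Fin 2) K} (hF : evalZero K F ≠ 0)
    (G u : MvPolynomial (Fin 2) K) :
    X 0 * u ∈ Ideal.span {F, X 0 * G} ↔ u ∈ Ideal.span {F, G} := by
  rw [Ideal.mem_span_pair, Ideal.mem_span_pair]
  constructor
  · rintro ⟨a, b, h⟩
    have h1 : evalZero K a = 0 := by
      have := congrArg (evalZero K) h
      simpa [hF] using this
    obtain ⟨a', rfl⟩ := (evalZero_eq_zero_iff a).1 h1
    refine ⟨a', b, mul_left_cancel₀ (X_ne_zero (0 : Fin 2)) ?_⟩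
    rw [← h]; ring
  · rintro ⟨a, b, rfl⟩
    exact ⟨X 0 * a, b, by ring⟩

/-- Modulo `x` the colon ideal becomes `(y ^ h)`, and `K[y] / (y ^ h)` has dimension `h`. -/
lemma HasColumns.degree_eq {I : Ideal (MvPolynomial (Fin 2) K)} {N : ℕ → ℕ}
    (hN : HasColumns I (X 0) N) {c h : ℕ} {F G : MvPolynomial (Fin 2) K}
    (hF : F.IsHomogeneous h) (hF0 : evalZero K F ≠ 0)
    (hI : ∀ u, X 0 ^ c * u ∈ I ↔ u ∈ Ideal.span {F, X 0 * G}) : h = N c := by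
  obtain ⟨θ, hs, hk⟩ := hN c
  let μ : MvPolynomial (Fin 2) K →ₗ[K] (Fin h → K) :=
    LinearMap.pi fun i => Polynomial.lcoeff K i ∘ₗ (evalZero K).toLinearMap
  have hμ : ∀ u i, μ u i = (evalZero K u).coeff i := fun u i => rfl
  have hμs : Function.Surjective μ := by
    intro w
    obtain ⟨u, hu⟩ := evalZero_surjective (K := K)
      (∑ i : Fin h, Polynomial.C (w i) * Polynomial.X ^ (i : ℕ))
    refine ⟨u, funext fun i => ?_⟩
    rw [hμ, hu, Polynomial.finsetSum_coeff, Finset.sum_eq_single i]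
    · simp
    · intro j _ hj
      rw [Polynomial.coeff_C_mul_X_pow, if_neg]
      exact fun h => hj (Fin.ext h.symm)
    · simp
  have hμk : ∀ u, μ u = 0 ↔ Polynomial.X ^ h ∣ evalZero K u := by
    intro u
    rw [Polynomial.X_pow_dvd_iff]
    constructor
    · exact fun hu d hd => congrFun hu ⟨d, hd⟩
    · exact fun hu => funext fun i => hu i i.2
  obtain ⟨a, ha⟩ := evalZero_of_isHomogeneous hF
  have ha0 : a ≠ 0 := by
    rintro rfl
    simp [ha] at hF0
  have hker : LinearMap.ker θ = LinearMap.ker μ := by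
    ext u
    rw [LinearMap.mem_ker, LinearMap.mem_ker, hk, hμk]
    simp only [hI]
    constructor
    · rintro ⟨v, hv⟩
      obtain ⟨α, β, h1⟩ := Ideal.mem_span_pair.1 hv
      have h2 := congrArg (evalZero K) h1
      simp only [map_add, map_mul, map_sub, evalZero_X_zero, zero_mul, mul_zero, add_zero,
        sub_zero, ha] at h2
      exact ⟨evalZero K α * Polynomial.C a, by rw [← h2]; ring⟩
    · rintro ⟨q, hq⟩
      obtain ⟨α, hα⟩ := evalZero_surjective (K := K) (Polynomial.C a⁻¹ * q)
      have h1 : evalZero K (u - α * F) = 0 := by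
        rw [map_sub, map_mul, hα, ha, hq]
        have : Polynomial.C a⁻¹ * Polynomial.C a = (1 : Polynomial K) := by
          rw [← Polynomial.C_mul, inv_mul_cancel₀ ha0, Polynomial.C_1]
        linear_combination (-Polynomial.X ^ h * q) * this
      obtain ⟨v, hv⟩ := (evalZero_eq_zero_iff _).1 h1
      refine ⟨v, Ideal.mem_span_pair.2 ⟨α, 0, ?_⟩⟩
      linear_combination -hv
  have e := ((LinearMap.quotKerEquivOfSurjective μ hμs).symm.trans
    (Submodule.quotEquivOfEq _ _ hker.symm)).trans (LinearMap.quotKerEquivOfSurjective θ hs)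
  simpa using e.finrank_eq

/-- The colon ideal `I : x ^ c` is generated by a form `F` prime to `x`, of the degree `N c`, and
by `x` times a form of degree `e`. -/
def IsColumnState (I : Ideal (MvPolynomial (Fin 2) K)) (N : ℕ → ℕ) (c e : ℕ) : Prop :=
  ∃ F G : MvPolynomial (Fin 2) K, F.IsHomogeneous (N c) ∧ evalZero K F ≠ 0 ∧
    G.IsHomogeneous e ∧ ∀ u, X 0 ^ c * u ∈ I ↔ u ∈ Ideal.span {F, X 0 * G}

/-- A colon ideal `(F)` with `F` prime to `x` is unchanged by further division by `x`, so all later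
column lengths equal `h`, whereas they are eventually `0`. -/
lemma HasColumns.eq_zero_of_principal {I : Ideal (MvPolynomial (Fin 2) K)} {N : ℕ → ℕ}
    (hN : HasColumns I (X 0) N) (hN0 : ∃ M, ∀ c, M ≤ c → N c = 0) {c h : ℕ}
    {F : MvPolynomial (Fin 2) K} (hF : F.IsHomogeneous h) (hF0 : evalZero K F ≠ 0)
    (hI : ∀ u, X 0 ^ c * u ∈ I ↔ u ∈ Ideal.span {F, X 0 * 0}) : h = 0 := by
  have key : ∀ m u, X 0 ^ (c + m) * u ∈ I ↔ u ∈ Ideal.span {F, X 0 * 0} := by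
    intro m
    induction m with
    | zero => exact hI
    | succ m ih =>
      intro u
      rw [← add_assoc, pow_succ, mul_assoc, ih, mul_X_mem_span_pair_iff hF0, mul_zero]
  obtain ⟨M, hM⟩ := hN0
  rw [hN.degree_eq hF hF0 (key M), hM _ (Nat.le_add_left _ _)]

/-- A form is divisible by `x` once its pure power of `y` is gone; when `h ≤ e + 1`, a multiple of
`y ^ (e + 1 - h) * F` removes it. -/
lemma exists_span_pair_eq {h e : ℕ} {F G : MvPolynomial (Fin 2) K}
    (hF : F.IsHomogeneous h) (hF0 : evalZero K F ≠ 0) (hG : G.IsHomogeneous (e + 1))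
    (hGF : evalZero K G = 0 ∨ h ≤ e + 1) :
    ∃ G' : MvPolynomial (Fin 2) K, G'.IsHomogeneous e ∧
      Ideal.span {F, G} = Ideal.span {F, X 0 * G'} := by
  rcases hGF with hG0 | hle
  · obtain ⟨G', hG', rfl⟩ := exists_eq_X_mul_of_isHomogeneous hG hG0
    exact ⟨G', hG', rfl⟩
  · obtain ⟨a, ha⟩ := evalZero_of_isHomogeneous hF
    obtain ⟨b, hb⟩ := evalZero_of_isHomogeneous hG
    have ha0 : a ≠ 0 := by
      rintro rfl
      simp [ha] at hF0
    have hhom : (G + C (-(b * a⁻¹)) * X 1 ^ (e + 1 - h) * F).IsHomogeneous (e + 1) := by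
      refine hG.add ?_
      have : e + 1 = 0 + (e + 1 - h) + h := by omega
      nth_rewrite 2 [this]
      exact ((isHomogeneous_C _ _).mul (isHomogeneous_X_pow _ _)).mul hF
    obtain ⟨G', hG', h1⟩ := exists_eq_X_mul_of_isHomogeneous hhom (by
      have h2 : (Polynomial.X : Polynomial K) ^ (e + 1) =
          Polynomial.X ^ (e + 1 - h) * Polynomial.X ^ h := by
        rw [← pow_add]; congr 1; omega
      have h3 : Polynomial.C (b * a⁻¹) * Polynomial.C a = Polynomial.C b := by
        rw [← Polynomial.C_mul, mul_assoc, inv_mul_cancel₀ ha0, mul_one]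
      simp only [map_add, map_mul, map_pow, map_neg, evalZero_C, evalZero_X_one, ha, hb, h2] at h3 ⊢
      linear_combination (-Polynomial.X ^ (e + 1 - h) * Polynomial.X ^ h) * h3)
    refine ⟨G', hG', ?_⟩
    rw [← h1]
    ext u
    rw [Ideal.mem_span_pair, Ideal.mem_span_pair]
    constructor
    · rintro ⟨α, β, rfl⟩
      exact ⟨α - β * (C (-(b * a⁻¹)) * X 1 ^ (e + 1 - h)), β, by ring⟩
    · rintro ⟨α, β, rfl⟩
      exact ⟨α + β * (C (-(b * a⁻¹)) * X 1 ^ (e + 1 - h)), β, by ring⟩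

end Columns

/-! ### The Euclidean step, its initial state, and linear coordinate changes. -/

section Transitions

variable {K : Type*} [Field K]

/-- The next colon ideal is `(F, G)`. The alternatives are reduction of `G` by `F`, or of `F` by `G`
when `G` is prime to `x` and of smaller degree. -/
lemma IsColumnState.step {I : Ideal (MvPolynomial (Fin 2) K)} {N : ℕ → ℕ}
    (hN : HasColumns I (X 0) N) (hN0 : ∃ M, ∀ c, M ≤ c → N c = 0) {c e : ℕ}
    (hc : 0 < N c) (h : IsColumnState I N c e) :
    (1 ≤ e ∧ N (c + 1) = N c ∧ IsColumnState I N (c + 1) (e - 1)) ∨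
      (e < N c ∧ N (c + 1) = e ∧ IsColumnState I N (c + 1) (N c - 1)) := by
  obtain ⟨F, G, hF, hF0, hG, hI⟩ := h
  have hI' : ∀ u, X 0 ^ (c + 1) * u ∈ I ↔ u ∈ Ideal.span {F, G} := fun u => by
    rw [pow_succ, mul_assoc, hI, mul_X_mem_span_pair_iff hF0]
  have hGne : G ≠ 0 := by
    rintro rfl
    exact hc.ne' (hN.eq_zero_of_principal hN0 hF hF0 hI)
  by_cases hcase : evalZero K G = 0 ∨ N c ≤ e
  · left
    have he : 1 ≤ e := by
      rcases hcase with h0 | h0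
      · by_contra hlt
        obtain rfl : e = 0 := by omega
        obtain ⟨a, rfl⟩ := eq_C_of_isHomogeneous_zero hG
        simp only [evalZero_C, Polynomial.C_eq_zero] at h0
        simp [h0] at hGne
      · omega
    obtain ⟨e, rfl⟩ := Nat.exists_eq_add_of_le' he
    obtain ⟨G', hG', hspan⟩ := exists_span_pair_eq hF hF0 hG hcase
    rw [hspan] at hI'
    have hdeg := hN.degree_eq hF hF0 hI'
    exact ⟨he, hdeg.symm, F, G', hdeg ▸ hF, hF0, by simpa using hG', hI'⟩
  · right
    push Not at hcase
    obtain ⟨hG0, hlt⟩ := hcase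
    obtain ⟨m, hm⟩ := Nat.exists_eq_add_of_le' hc
    rw [hm] at hF hlt ⊢
    obtain ⟨F', hF', hspan⟩ := exists_span_pair_eq hG hG0 hF (Or.inr hlt.le)
    rw [Ideal.span_pair_comm, hspan] at hI'
    have hdeg := hN.degree_eq hG hG0 hI'
    exact ⟨hlt, hdeg.symm, G, F', hdeg ▸ hG, hG0, by simpa using hF', hI'⟩

lemma HasColumns.exists_isColumnState {f g : MvPolynomial (Fin 2) K} {a b : ℕ} {N : ℕ → ℕ}
    (hN : HasColumns (Ideal.span {f, g}) (X 0) N) (ha : 0 < a) (hb : 0 < b)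
    (hf : f.IsHomogeneous a) (hg : g.IsHomogeneous b) :
    ∃ e, IsColumnState (Ideal.span {f, g}) N 0 e := by
  have key : ∀ {f g : MvPolynomial (Fin 2) K} {a b : ℕ},
      HasColumns (Ideal.span {f, g}) (X 0) N → 0 < b → f.IsHomogeneous a →
      g.IsHomogeneous b → evalZero K f ≠ 0 → (evalZero K g = 0 ∨ a ≤ b) →
      ∃ e, IsColumnState (Ideal.span {f, g}) N 0 e := by
    intro f g a b hN hb hf hg hf0 hcase
    obtain ⟨e, rfl⟩ := Nat.exists_eq_add_of_le' hb
    obtain ⟨G, hG, hspan⟩ := exists_span_pair_eq hf hf0 hg hcase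
    rw [hspan] at hN ⊢
    have hI : ∀ u, X 0 ^ 0 * u ∈ Ideal.span {f, X 0 * G} ↔ u ∈ Ideal.span {f, X 0 * G} :=
      fun u => by rw [pow_zero, one_mul]
    have hdeg := hN.degree_eq hf hf0 hI
    exact ⟨e, f, G, hdeg ▸ hf, hf0, hG, hI⟩
  by_cases hf0 : evalZero K f = 0
  · by_cases hg0 : evalZero K g = 0
    -- Here the ideal lies in `(x)`, so `K[y]` would embed in the finite-dimensional column `0`.
    · exfalso
      obtain ⟨θ, -, hk⟩ := hN 0
      have hle : ∀ u ∈ Ideal.span {f, g}, evalZero K u = 0 := by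
        intro u hu
        obtain ⟨α, β, rfl⟩ := Ideal.mem_span_pair.1 hu
        simp [hf0, hg0]
      let ψ : Polynomial K →ₗ[K] (Fin (N 0) → K) :=
        θ ∘ₗ (Polynomial.aeval (X 1 : MvPolynomial (Fin 2) K)).toLinearMap
      have hψ : Function.Injective ψ := by
        rw [injective_iff_map_eq_zero]
        intro q hq
        obtain ⟨v, hv⟩ := (hk _).1 hq
        have := hle _ hv
        simpa [evalZero_aeval] using this
      have : Module.Finite K (Polynomial K) := Module.Finite.of_injective ψ hψ
      exact Polynomial.not_finite this
    · rw [Ideal.span_pair_comm] at hN ⊢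
      exact key hN ha hg hf hg0 (Or.inl hf0)
  · by_cases hg0 : evalZero K g = 0
    · exact key hN hb hf hg hf0 (Or.inl hg0)
    · rcases le_total a b with hab | hab
      · exact key hN hb hf hg hf0 (Or.inr hab)
      · rw [Ideal.span_pair_comm] at hN ⊢
        exact key hN ha hg hf hg0 (Or.inr hab)

/-- A nonzero linear form is the first coordinate of a linear change of coordinates. -/
lemma exists_algEquiv_X_zero {ℓ : MvPolynomial (Fin 2) K} (hℓ : ℓ.IsHomogeneous 1)
    (h0 : ℓ ≠ 0) :
    ∃ σ : MvPolynomial (Fin 2) K ≃ₐ[K] MvPolynomial (Fin 2) K, σ (X 0) = ℓ ∧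
      ∀ (n : ℕ) (F : MvPolynomial (Fin 2) K), F.IsHomogeneous n →
        (σ.symm F).IsHomogeneous n := by
  obtain ⟨b, G, hG, rfl⟩ := exists_decomp_of_isHomogeneous hℓ
  obtain ⟨a, rfl⟩ := eq_C_of_isHomogeneous_zero hG
  have hom : ∀ α β : K, (C α * X 0 + C β * X 1 : MvPolynomial (Fin 2) K).IsHomogeneous 1 :=
    fun α β => by
      simpa using ((isHomogeneous_C (Fin 2) α).mul (isHomogeneous_X K 0)).add
        ((isHomogeneous_C (Fin 2) β).mul (isHomogeneous_X K 1))
  have main : ∀ v w : Fin 2 → MvPolynomial (Fin 2) K, (∀ i, (w i).IsHomogeneous 1) →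
      (∀ i, aeval v (w i) = X i) → (∀ i, aeval w (v i) = X i) →
      ∃ σ : MvPolynomial (Fin 2) K ≃ₐ[K] MvPolynomial (Fin 2) K, σ (X 0) = v 0 ∧
        ∀ (n : ℕ) (F : MvPolynomial (Fin 2) K), F.IsHomogeneous n →
          (σ.symm F).IsHomogeneous n := by
    intro v w hw h1 h2
    refine ⟨AlgEquiv.ofAlgHom (aeval v) (aeval w) (algHom_ext fun i => by
        rw [AlgHom.comp_apply, aeval_X, h1]; rfl)
      (algHom_ext fun i => by
        rw [AlgHom.comp_apply, aeval_X, h2]; rfl), by simp, fun n F hF => ?_⟩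
    have := hF.aeval w hw
    rw [one_mul] at this
    exact this
  have hC : ∀ c : K, c ≠ 0 → (C c * C c⁻¹ : MvPolynomial (Fin 2) K) = 1 := fun c hc => by
    rw [← C_mul, mul_inv_cancel₀ hc, C_1]
  by_cases ha : a = 0
  · have hb : b ≠ 0 := by
      rintro rfl
      simp [ha] at h0
    obtain ⟨σ, h1, h2⟩ := main ![C b * X 1, X 0] ![X 1, C b⁻¹ * X 0]
      (by
        intro i
        fin_cases i
        · exact isHomogeneous_X K 1
        · simpa using hom b⁻¹ 0)
      (by
        intro i
        fin_cases i
        · simp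
        · simp [algebraMap_eq]
          linear_combination X 1 * hC b hb)
      (by
        intro i
        fin_cases i
        · simp [← mul_assoc, hC b hb]
        · simp)
    exact ⟨σ, by rw [h1, ha]; simp, h2⟩
  · obtain ⟨σ, h1, h2⟩ := main ![C a * X 0 + C b * X 1, X 1]
      ![C a⁻¹ * X 0 + C (-(a⁻¹ * b)) * X 1, X 1]
      (by
        intro i
        fin_cases i
        · exact hom _ _
        · exact isHomogeneous_X K 1)
      (by
        intro i
        fin_cases i
        · simp [algebraMap_eq]
          linear_combination X 0 * hC a ha
        · simp)
      (by
        intro i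
        fin_cases i
        · simp [algebraMap_eq]
          linear_combination (X 0 - C b * X 1) * hC a ha
        · simp)
    exact ⟨σ, by rw [h1]; simp [mul_comm, add_comm], h2⟩

end Transitions

/-! ### Necessity of the relation between consecutive parts. -/

section Necessity

variable {K : Type*} [Field K] {P : YoungDiagram} {t : ℕ} {p n : Fin t → ℕ}

lemma IsColumnState.parts_eq {I : Ideal (MvPolynomial (Fin 2) K)}
    (hN : HasColumns I (X 0) P.colLen) (hP : IsPowerForm P p n) {e₀ : ℕ}
    (h₀ : IsColumnState I P.colLen 0 e₀) {i : ℕ} (hi : i + 1 < t) :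
    extendZero p i = extendZero n i + extendZero n (i + 1) + extendZero p (i + 1) := by
  have hN0 : ∃ M, ∀ c, M ≤ c → P.colLen c = 0 :=
    ⟨extendZero p 0, fun c hc => by simpa using hP.colLen_le hc⟩
  have hnpos : ∀ j, j < t → 0 < extendZero n j := fun j hj => by
    simpa [extendZero, hj] using hP.2.1 ⟨j, hj⟩
  have hpos : ∀ c j, j < t → c < extendZero p j → 0 < P.colLen c := fun c j hj hc => by
    have h1 := hP.le_colLen hj hc
    have h2 := hnpos j hj
    rw [partialSum_succ] at h1
    omega
  have hlt0 := hP.extendZero_succ_lt (i := i) (by omega)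
  have hlt1 := hP.extendZero_succ_lt hi
  set s := partialSum (extendZero n)
  have hs1 : s (i + 1) = s i + extendZero n i := partialSum_succ _ _
  have hs2 : s (i + 2) = s (i + 1) + extendZero n (i + 1) := partialSum_succ _ _
  have hn1 := hnpos (i + 1) hi
  have hn0 := hnpos i (by omega)
  have hstate : ∀ c, c ≤ extendZero p i → ∃ e, IsColumnState I P.colLen c e := by
    intro c
    induction c with
    | zero => exact fun _ => ⟨e₀, h₀⟩
    | succ c ih =>
      intro hc
      obtain ⟨e, he⟩ := ih (by omega)
      rcases he.step hN hN0 (hpos c i (by omega) (by omega)) with ⟨-, -, h⟩ | ⟨-, -, h⟩ <;>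
        exact ⟨_, h⟩
  have hcol : ∀ c, extendZero p (i + 1) ≤ c → c < extendZero p i → P.colLen c = s (i + 1) :=
    fun c h1 h2 => hP.colLen_eq_partialSum (by omega) h1 h2
  -- The column length changes on entering column `p (i + 1)`, so the second alternative holds there
  -- and resets `e` to the previous length minus one.
  have hdrop : IsColumnState I P.colLen (extendZero p (i + 1)) (s (i + 2) - 1) := by
    obtain ⟨c, hc⟩ : ∃ c, extendZero p (i + 1) = c + 1 := ⟨extendZero p (i + 1) - 1, by omega⟩
    have hc2 : P.colLen c = s (i + 2) := hP.colLen_eq_partialSum hi (by omega) (by omega)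
    have hc1 := hcol (c + 1) (by omega) (by omega)
    obtain ⟨e, he⟩ := hstate c (by omega)
    rcases he.step hN hN0 (hpos c (i + 1) hi (by omega)) with ⟨-, h, -⟩ | ⟨-, -, h⟩
    · omega
    · rw [hc, ← hc2]
      exact h
  -- While the length stays constant only the first alternative is possible. The bound `m + 1 ≤ s (i
  -- + 2)` keeps the subtraction from truncating.
  have hphase : ∀ m, extendZero p (i + 1) + m < extendZero p i → m + 1 ≤ s (i + 2) ∧
      IsColumnState I P.colLen (extendZero p (i + 1) + m) (s (i + 2) - 1 - m) := by
    intro m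
    induction m with
    | zero => exact fun _ => ⟨by omega, hdrop⟩
    | succ m ih =>
      intro hm
      obtain ⟨h1, h2⟩ := ih (by omega)
      have e1 := hcol (extendZero p (i + 1) + m) (by omega) (by omega)
      have e2 := hcol (extendZero p (i + 1) + m + 1) (by omega) (by omega)
      rcases h2.step hN hN0 (by omega) with ⟨h3, -, h⟩ | ⟨h3, h4, -⟩
      · exact ⟨by omega, by rw [Nat.sub_sub] at h; exact h⟩
      · omega
  have hend : P.colLen (extendZero p i) = s i := by
    rcases i with _ | i
    · exact Nat.le_zero.1 (hP.colLen_le le_rfl)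
    · exact hP.colLen_eq_partialSum (by omega) le_rfl (hP.extendZero_succ_lt (by omega))
  obtain ⟨m, hm⟩ : ∃ m, extendZero p i = extendZero p (i + 1) + m + 1 :=
    ⟨extendZero p i - extendZero p (i + 1) - 1, by omega⟩
  obtain ⟨h1, h2⟩ := hphase m (by omega)
  have e1 := hcol (extendZero p (i + 1) + m) (by omega) (by omega)
  rw [hm] at hend
  -- At column `p i` the length drops to `s i`, which must be the current `e = s (i + 2) - 1 - m`,
  -- where `m + 1 = p i - p (i + 1)`.
  rcases h2.step hN hN0 (by omega) with ⟨-, h, -⟩ | ⟨-, h, -⟩ <;> omega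

lemma IsCIJordanType.parts_eq {T : ℕ → ℕ} (h : IsCIJordanType K T P)
    (hP : IsPowerForm P p n) {i : ℕ} (hi : i + 1 < t) :
    extendZero p i = extendZero n i + extendZero n (i + 1) + extendZero p (i + 1) := by
  obtain ⟨I, ℓ, ⟨-, f, g, a, b, ha, hb, hf, hg, rfl⟩, -, hℓ, hJ⟩ := h
  -- Multiplication by `0` has only blocks of size `1`, but two distinct positive parts give a row
  -- of length at least `2`.
  have hℓ0 : ℓ ≠ 0 := by
    rintro rfl
    obtain ⟨B, hB⟩ := hJ
    have h1 := hP.extendZero_succ_lt (i := i) (by omega)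
    have h2 := hP.extendZero_succ_lt hi
    have h3 : ((0 : ℕ), 1) ∈ P := by
      rw [YoungDiagram.mem_iff_lt_colLen]
      have h4 := hP.le_colLen (i := i) (c := 1) (by omega) (by omega)
      have h5 := hP.2.1 ⟨i, by omega⟩
      rw [partialSum_succ, extendZero, dif_pos (by omega)] at h4
      omega
    have h4 := hB 0 0 (P.up_left_mem le_rfl (by omega) h3)
    rw [dif_pos h3, map_zero, LinearMap.mulLeft_apply, zero_mul] at h4
    exact B.ne_zero _ h4.symm
  obtain ⟨σ, hσ, hhom⟩ := exists_algEquiv_X_zero hℓ hℓ0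
  have hN := (hasColumns_of_hasJordanType hJ).comap σ
  have hspan : (Ideal.span {f, g}).comap σ = Ideal.span {σ.symm f, σ.symm g} := by
    ext u
    rw [Ideal.mem_comap, Ideal.mem_span_pair, Ideal.mem_span_pair]
    constructor
    · rintro ⟨α, β, h⟩
      exact ⟨σ.symm α, σ.symm β, by
        rw [← map_mul, ← map_mul, ← map_add, AlgEquiv.symm_apply_eq, h]⟩
    · rintro ⟨α, β, rfl⟩
      exact ⟨σ α, σ β, by simp⟩
  rw [← hσ, σ.symm_apply_apply, hspan] at hN
  obtain ⟨e, he⟩ := hN.exists_isColumnState ha hb (hhom _ _ hf) (hhom _ _ hg)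
  exact he.parts_eq hN hP hi

end Necessity

/-! ### Bases of `K[x, y]` adapted to powers of `x`. -/

section MonicFamily

variable {K : Type*} [Field K]

/-- A family of forms `u r` of degree `r` with `u r = y ^ r` modulo `x`. -/
def IsMonicFamily (u : ℕ → MvPolynomial (Fin 2) K) : Prop :=
  ∀ r, (u r).IsHomogeneous r ∧ evalZero K (u r) = Polynomial.X ^ r

variable {u : ℕ → MvPolynomial (Fin 2) K}

/-- Subtracting a multiple of `u m` leaves `x` times a form of smaller degree, to which induction
applies. -/
lemma IsMonicFamily.mem_span (hu : IsMonicFamily u) {m : ℕ} {F : MvPolynomial (Fin 2) K}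
    (hF : F.IsHomogeneous m) :
    F ∈ Submodule.span K {v | ∃ r c, r + c = m ∧ v = X 0 ^ c * u r} := by
  induction m generalizing F with
  | zero =>
    obtain ⟨a, rfl⟩ := eq_C_of_isHomogeneous_zero hF
    obtain ⟨b, hb⟩ := eq_C_of_isHomogeneous_zero (hu 0).1
    have h1 := (hu 0).2
    rw [hb, evalZero_C, pow_zero, ← Polynomial.C_1, Polynomial.C_inj] at h1
    have : (C a : MvPolynomial (Fin 2) K) = a • (X 0 ^ 0 * u 0) := by
      rw [hb, h1, smul_eq_C_mul]; simp
    rw [this]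
    exact Submodule.smul_mem _ _ (Submodule.subset_span ⟨0, 0, rfl, rfl⟩)
  | succ m ih =>
    obtain ⟨a, G, hG, rfl⟩ := exists_decomp_of_isHomogeneous hF
    obtain ⟨b, G', hG', hb⟩ := exists_decomp_of_isHomogeneous (hu (m + 1)).1
    have h1 := (hu (m + 1)).2
    have hb1 : b = 1 := by
      rw [hb] at h1
      have := congrArg (fun q => Polynomial.coeff q (m + 1)) h1
      simpa using this
    have hx : ∀ H ∈ Submodule.span K {v | ∃ r c, r + c = m ∧ v = X 0 ^ c * u r},
        X 0 * H ∈ Submodule.span K {v | ∃ r c, r + c = m + 1 ∧ v = X 0 ^ c * u r} := by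
      intro H hH
      induction hH using Submodule.span_induction with
      | mem v hv =>
        obtain ⟨r, c, hrc, rfl⟩ := hv
        exact Submodule.subset_span ⟨r, c + 1, by omega, by ring⟩
      | zero => simp
      | add v w _ _ hv hw => rw [mul_add]; exact Submodule.add_mem _ hv hw
      | smul k v _ hv => rw [mul_smul_comm]; exact Submodule.smul_mem _ _ hv
    have : C a * X 1 ^ (m + 1) + X 0 * G =
        a • (X 0 ^ 0 * u (m + 1)) + X 0 * (G + C (-a) * G') := by
      rw [hb, hb1, smul_eq_C_mul]
      simp only [map_neg, C_1]
      ring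
    rw [this]
    refine Submodule.add_mem _ (Submodule.smul_mem _ _
      (Submodule.subset_span ⟨m + 1, 0, rfl, rfl⟩)) (hx _ (ih (hG.add ?_)))
    simpa using (isHomogeneous_C (Fin 2) (-a)).mul hG'

lemma IsMonicFamily.span_eq_top (hu : IsMonicFamily u) :
    ⊤ ≤ Submodule.span K (Set.range fun i : ℕ × ℕ => X 0 ^ i.2 * u i.1) := by
  intro F _
  rw [← sum_homogeneousComponent F]
  refine Submodule.sum_mem _ fun m _ => ?_
  refine Submodule.span_mono ?_ (hu.mem_span (homogeneousComponent_isHomogeneous m F))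
  rintro _ ⟨r, c, -, rfl⟩
  exact ⟨(r, c), rfl⟩

/-- Setting `x = 0` kills `f 0`, since the `u r` restrict to distinct powers of `y`; then cancel `x`
and repeat. -/
lemma IsMonicFamily.coeffs_eq_zero (hu : IsMonicFamily u) (m : ℕ) :
    ∀ f : ℕ → ℕ →₀ K, ∑ c ∈ Finset.range m, X 0 ^ c * Finsupp.linearCombination K u (f c) = 0 →
      ∀ c < m, f c = 0 := by
  induction m with
  | zero => intro f _ c hc; omega
  | succ m ih =>
    intro f hf
    have hev : ∀ g : ℕ →₀ K, evalZero K (Finsupp.linearCombination K u g) = 0 → g = 0 := by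
      intro g hg
      ext r
      have := congrArg (fun q => Polynomial.coeff q r) hg
      simp only [Finsupp.linearCombination_apply, Finsupp.sum, map_sum, map_smul, (hu _).2,
        Polynomial.finsetSum_coeff, Polynomial.coeff_smul, Polynomial.coeff_X_pow,
        smul_eq_mul, mul_ite, mul_one, mul_zero, Finset.sum_ite_eq, Polynomial.coeff_zero] at this
      simpa using this
    rw [Finset.sum_range_succ', pow_zero, one_mul] at hf
    have h1 : ∑ c ∈ Finset.range m,
          X 0 ^ (c + 1) * Finsupp.linearCombination K u (f (c + 1)) =
        X 0 * ∑ c ∈ Finset.range m, X 0 ^ c * Finsupp.linearCombination K u (f (c + 1)) := by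
      rw [Finset.mul_sum]
      exact Finset.sum_congr rfl fun c _ => by ring
    rw [h1] at hf
    have h0 : f 0 = 0 := by
      refine hev _ ?_
      have := congrArg (evalZero K) hf
      simpa using this
    rw [h0, map_zero, add_zero] at hf
    have h2 := ih (fun c => f (c + 1)) ((mul_eq_zero.1 hf).resolve_left (X_ne_zero _))
    rintro (_ | c) hc
    · exact h0
    · exact h2 c (by omega)

lemma IsMonicFamily.linearIndependent (hu : IsMonicFamily u) :
    LinearIndependent K (fun i : ℕ × ℕ => X 0 ^ i.2 * u i.1) := by
  have hswap : LinearIndependent K (fun i : ℕ × ℕ => X 0 ^ i.1 * u i.2) := by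
    rw [linearIndependent_iff]
    intro g hg
    have h1 : Finsupp.linearCombination K (fun i : ℕ × ℕ => X 0 ^ i.1 * u i.2) g =
        g.curry.sum fun c f => X 0 ^ c * Finsupp.linearCombination K u f := by
      rw [Finsupp.linearCombination_apply]
      simp only [Finsupp.linearCombination_apply, Finsupp.sum, Finset.mul_sum, mul_smul_comm]
      exact (Finsupp.sum_curry_index g fun c r k => k • (X 0 ^ c * u r)).symm
    rw [h1] at hg
    obtain ⟨m, hm⟩ := g.curry.support.exists_nat_subset_range
    rw [Finsupp.sum_of_support_subset _ hm _ (by simp)] at hg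
    have h2 := hu.coeffs_eq_zero m _ hg
    ext ⟨c, r⟩
    rw [← Finsupp.curry_apply]
    by_cases hc : c < m
    · rw [h2 c hc]; rfl
    · have : g.curry c = 0 := by
        by_contra hne
        exact hc (Finset.mem_range.1 (hm (Finsupp.mem_support_iff.2 hne)))
      rw [this]; rfl
  exact hswap.comp Prod.swap Prod.swap_injective

/-- The basis `x ^ c * u r` of `K[x, y]` attached to a monic family. -/
noncomputable def IsMonicFamily.basis (hu : IsMonicFamily u) :
    Module.Basis (ℕ × ℕ) K (MvPolynomial (Fin 2) K) :=
  Module.Basis.mk hu.linearIndependent hu.span_eq_top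

lemma IsMonicFamily.basis_apply (hu : IsMonicFamily u) (r c : ℕ) :
    hu.basis (r, c) = X 0 ^ c * u r := by
  simp [IsMonicFamily.basis]

/-- If the `x ^ c * u r` with `(r, c) ∉ P` span an ideal `I`, then the remaining ones give a
basis of `K[x, y] / I`. -/
lemma IsMonicFamily.exists_quotient_basis (hu : IsMonicFamily u) {P : YoungDiagram}
    {I : Ideal (MvPolynomial (Fin 2) K)}
    (hmem : ∀ r c, (r, c) ∉ P → X 0 ^ c * u r ∈ I)
    (hI : ∀ F ∈ I, ∀ i ∈ P, hu.basis.repr F i = 0) :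
    ∃ b : Module.Basis {c : ℕ × ℕ // c ∈ P} K (MvPolynomial (Fin 2) K ⧸ I),
      ∀ r c h, b ⟨(r, c), h⟩ = Ideal.Quotient.mk I (X 0 ^ c * u r) := by
  classical
  have : Fintype {c : ℕ × ℕ // c ∈ P} := Fintype.subtype P.cells fun _ => Iff.rfl
  let μ : MvPolynomial (Fin 2) K →ₗ[K] ({c : ℕ × ℕ // c ∈ P} → K) :=
    LinearMap.pi fun i => hu.basis.coord i
  have hμ : ∀ F i, μ F i = hu.basis.repr F i := fun F i => rfl
  have hker : I.restrictScalars K = LinearMap.ker μ := by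
    ext F
    rw [LinearMap.mem_ker, Submodule.restrictScalars_mem]
    constructor
    · exact fun hF => funext fun i => hI F hF i i.2
    · intro hF
      rw [← hu.basis.linearCombination_repr F, Finsupp.linearCombination_apply, Finsupp.sum]
      refine Submodule.sum_mem _ ?_
      rintro ⟨r, c⟩ hrc
      rw [smul_eq_C_mul, hu.basis_apply]
      refine Ideal.mul_mem_left _ _ (hmem r c fun h => ?_)
      exact Finsupp.mem_support_iff.1 hrc (congrFun hF ⟨(r, c), h⟩)
  have hμb : ∀ i : {c : ℕ × ℕ // c ∈ P}, μ (hu.basis i) = Pi.single i 1 := by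
    intro i
    ext j
    rw [hμ, hu.basis.repr_self, Finsupp.single_apply, Pi.single_apply]
    simp only [Subtype.ext_iff, eq_comm]
  have hsurj : Function.Surjective μ := by
    rw [← LinearMap.range_eq_top, eq_top_iff, ← (Pi.basisFun K _).span_eq, Submodule.span_le]
    rintro _ ⟨i, rfl⟩
    exact ⟨hu.basis i, by rw [hμb, Pi.basisFun_apply]⟩
  let e : (MvPolynomial (Fin 2) K ⧸ I) ≃ₗ[K] ({c : ℕ × ℕ // c ∈ P} → K) :=
    (Submodule.quotEquivOfEq (I.restrictScalars K) _ hker).trans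
      (LinearMap.quotKerEquivOfSurjective μ hsurj)
  have he : ∀ F, e (Ideal.Quotient.mk I F) = μ F := fun F => rfl
  refine ⟨Module.Basis.ofEquivFun e, fun r c h => ?_⟩
  rw [Module.Basis.coe_ofEquivFun, LinearEquiv.symm_apply_eq, he, ← hμb, hu.basis_apply]

lemma IsMonicFamily.hilbertFunction_eq (hu : IsMonicFamily u) {P : YoungDiagram}
    {I : Ideal (MvPolynomial (Fin 2) K)}
    (hmem : ∀ r c, (r, c) ∉ P → X 0 ^ c * u r ∈ I)
    (b : Module.Basis {c : ℕ × ℕ // c ∈ P} K (MvPolynomial (Fin 2) K ⧸ I))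
    (hb : ∀ r c h, b ⟨(r, c), h⟩ = Ideal.Quotient.mk I (X 0 ^ c * u r)) (m : ℕ) :
    hilbertFunction I m = diagonalLength P m := by
  have hmap : (homogeneousSubmodule (Fin 2) K m).map (Ideal.Quotient.mkₐ K I).toLinearMap =
      Submodule.span K (Set.range fun i : {i : {c : ℕ × ℕ // c ∈ P} // i.1.1 + i.1.2 = m} =>
        b i.1) := by
    refine le_antisymm ?_ ?_
    · rw [Submodule.map_le_iff_le_comap]
      intro F hF
      rw [mem_homogeneousSubmodule] at hF
      refine Submodule.span_le.2 ?_ (hu.mem_span hF)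
      rintro _ ⟨r, c, hrc, rfl⟩
      rw [SetLike.mem_coe, Submodule.mem_comap, AlgHom.toLinearMap_apply,
        Ideal.Quotient.mkₐ_eq_mk]
      by_cases h : (r, c) ∈ P
      · rw [← hb r c h]
        exact Submodule.subset_span ⟨⟨⟨(r, c), h⟩, hrc⟩, rfl⟩
      · rw [Ideal.Quotient.eq_zero_iff_mem.2 (hmem r c h)]
        exact Submodule.zero_mem _
    · rw [Submodule.span_le]
      rintro _ ⟨⟨⟨⟨r, c⟩, h⟩, hrc⟩, rfl⟩
      refine ⟨X 0 ^ c * u r, ?_, (hb r c h).symm⟩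
      rw [SetLike.mem_coe, mem_homogeneousSubmodule]
      have : m = c + r := by simpa [add_comm] using hrc.symm
      rw [this]
      exact (isHomogeneous_X_pow _ _).mul (hu r).1
  let ε : {i : {c : ℕ × ℕ // c ∈ P} // i.1.1 + i.1.2 = m} ≃
      {i // i ∈ P.cells.filter fun c => c.1 + c.2 = m} :=
    { toFun := fun i => ⟨i.1.1, Finset.mem_filter.2 ⟨i.1.2, i.2⟩⟩
      invFun := fun i => ⟨⟨i.1, (Finset.mem_filter.1 i.2).1⟩, (Finset.mem_filter.1 i.2).2⟩
      left_inv := fun _ => rfl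
      right_inv := fun _ => rfl }
  have := Fintype.ofEquiv _ ε.symm
  have hli : LinearIndependent K
      (fun i : {i : {c : ℕ × ℕ // c ∈ P} // i.1.1 + i.1.2 = m} => b i.1) :=
    b.linearIndependent.comp _ Subtype.val_injective
  rw [hilbertFunction, hmap, finrank_span_eq_card hli, diagonalLength, Fintype.card_congr ε,
    Fintype.card_coe]

lemma hasJordanType_of_basis {P : YoungDiagram}
    {I : Ideal (MvPolynomial (Fin 2) K)}
    (hmem : ∀ r c, (r, c) ∉ P → X 0 ^ c * u r ∈ I)
    (b : Module.Basis {c : ℕ × ℕ // c ∈ P} K (MvPolynomial (Fin 2) K ⧸ I))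
    (hb : ∀ r c h, b ⟨(r, c), h⟩ = Ideal.Quotient.mk I (X 0 ^ c * u r)) :
    HasJordanType (LinearMap.mulLeft K (Ideal.Quotient.mk I (X 0))) P := by
  refine ⟨b, fun r c h => ?_⟩
  have h1 : X 0 * (X 0 ^ c * u r) = X 0 ^ (c + 1) * u r := by ring
  rw [LinearMap.mulLeft_apply, hb, ← map_mul, h1]
  split_ifs with h'
  · rw [hb]
  · exact Ideal.Quotient.eq_zero_iff_mem.2 (hmem _ _ h')

end MonicFamily

/-! ### Continuants and the complete intersection realizing `P`. -/

section Construction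

variable {K : Type*} [Field K]

/-- The polynomials `g 0 = 1`, `g 1 = y ^ n 0`,
`g (i + 2) = y ^ n (i + 1) * g (i + 1) - x ^ (p i - p (i + 1)) * g i`. -/
noncomputable def continuant (K : Type*) [Field K] (p n : ℕ → ℕ) :
    ℕ → MvPolynomial (Fin 2) K
  | 0 => 1
  | 1 => X 1 ^ n 0
  | i + 2 => X 1 ^ n (i + 1) * continuant K p n (i + 1) -
      X 0 ^ (p i - p (i + 1)) * continuant K p n i

/-- The index of the block, cut out by the partial sums of `n`, that contains `r`. -/
def blockIndex (n : ℕ → ℕ) (t r : ℕ) : ℕ := Nat.findGreatest (fun i => partialSum n i ≤ r) t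

/-- The monic form of degree `r` obtained from the continuant of its block. -/
noncomputable def blockForm (K : Type*) [Field K] (p n : ℕ → ℕ) (t r : ℕ) :
    MvPolynomial (Fin 2) K :=
  X 1 ^ (r - partialSum n (blockIndex n t r)) * continuant K p n (blockIndex n t r)

variable {p n : ℕ → ℕ} {t : ℕ}

lemma blockIndex_le (r : ℕ) : blockIndex n t r ≤ t := Nat.findGreatest_le _

lemma partialSum_blockIndex_le (r : ℕ) : partialSum n (blockIndex n t r) ≤ r :=
  Nat.findGreatest_spec (P := fun i => partialSum n i ≤ r) (Nat.zero_le t) (Nat.zero_le r)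

/-- The last block, of index `t`, has no upper end; hence the guarded bound. -/
lemma blockIndex_eq {i r : ℕ} (hi : i ≤ t) (h1 : partialSum n i ≤ r)
    (h2 : i < t → r < partialSum n (i + 1)) : blockIndex n t r = i := by
  refine le_antisymm ?_ (Nat.le_findGreatest hi h1)
  by_contra hlt
  have h3 := blockIndex_le (n := n) (t := t) r
  have h4 := partialSum_blockIndex_le (n := n) (t := t) r
  have h5 := partialSum_mono n (show i + 1 ≤ blockIndex n t r by omega)
  have h6 := h2 (by omega)
  omega

lemma lt_partialSum_of_blockIndex {r : ℕ} (h : blockIndex n t r < t) :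
    r < partialSum n (blockIndex n t r + 1) := by
  by_contra hlt
  have : blockIndex n t r + 1 ≤ blockIndex n t r :=
    Nat.le_findGreatest (P := fun i => partialSum n i ≤ r) h (not_lt.1 hlt)
  omega

/-- The relation on the parts enters here: it gives both terms of the recursion the same degree. -/
lemma continuant_isHomogeneous
    (hpn : ∀ i, i + 1 < t → p i = n i + n (i + 1) + p (i + 1)) :
    ∀ i, i ≤ t → (continuant K p n i).IsHomogeneous (partialSum n i)
  | 0, _ => isHomogeneous_one _ _
  | 1, _ => by
    simpa [continuant, partialSum] using isHomogeneous_X_pow (R := K) (1 : Fin 2) (n 0)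
  | i + 2, hi => by
    have h1 := continuant_isHomogeneous hpn (i + 1) (by omega)
    have h0 := continuant_isHomogeneous hpn i (by omega)
    have h2 := hpn i (by omega)
    have e1 : partialSum n (i + 2) = n (i + 1) + partialSum n (i + 1) := by
      rw [partialSum_succ, add_comm]
    have e2 : partialSum n (i + 2) = p i - p (i + 1) + partialSum n i := by
      rw [e1, partialSum_succ]; omega
    rw [continuant]
    refine IsHomogeneous.sub ?_ ?_
    · rw [e1]
      exact (isHomogeneous_X_pow _ _).mul h1
    · rw [e2]
      exact (isHomogeneous_X_pow _ _).mul h0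

lemma evalZero_continuant (hp : ∀ i, i < t → p (i + 1) < p i) :
    ∀ i, i ≤ t → evalZero K (continuant K p n i) = Polynomial.X ^ partialSum n i
  | 0, _ => by simp [continuant]
  | 1, _ => by simp [continuant, partialSum]
  | i + 2, hi => by
    have h2 := hp i (by omega)
    have h3 : p i - p (i + 1) ≠ 0 := by omega
    rw [continuant, map_sub, map_mul, map_mul, map_pow, map_pow, evalZero_X_zero,
      evalZero_X_one, evalZero_continuant hp (i + 1) (by omega), zero_pow h3,
      partialSum_succ n (i + 1)]
    ring

lemma isMonicFamily_blockForm (hp : ∀ i, i < t → p (i + 1) < p i)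
    (hpn : ∀ i, i + 1 < t → p i = n i + n (i + 1) + p (i + 1)) :
    IsMonicFamily (blockForm K p n t) := by
  intro r
  have h1 := partialSum_blockIndex_le (n := n) (t := t) r
  have h2 : r - partialSum n (blockIndex n t r) + partialSum n (blockIndex n t r) = r := by omega
  constructor
  · have := (isHomogeneous_X_pow (R := K) (1 : Fin 2)
      (r - partialSum n (blockIndex n t r))).mul
      (continuant_isHomogeneous hpn _ (blockIndex_le (n := n) r))
    rwa [h2] at this
  · rw [blockForm, map_mul, map_pow, evalZero_X_one, evalZero_continuant hp _ (blockIndex_le r),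
      ← pow_add, h2]

lemma blockForm_partialSum (hn : ∀ i, i < t → 0 < n i) {i : ℕ} (hi : i ≤ t) :
    blockForm K p n t (partialSum n i) = continuant K p n i := by
  have : blockIndex n t (partialSum n i) = i := blockIndex_eq hi le_rfl fun h => by
    have := hn i h
    rw [partialSum_succ]; omega
  rw [blockForm, this]; simp

/-- Multiplication by `y` just raises the power of `y`, except at the last row of a block, where the
continuant recursion adds a correction (none for the first block). -/
lemma X_mul_blockForm (hn : ∀ i, i < t → 0 < n i) (r : ℕ) :
    X 1 * blockForm K p n t r = blockForm K p n t (r + 1) ∨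
      ∃ i, i + 1 < t ∧ partialSum n (i + 1) ≤ r ∧ r < partialSum n (i + 2) ∧
        X 1 * blockForm K p n t r = blockForm K p n t (r + 1) +
          X 0 ^ (p i - p (i + 1)) * blockForm K p n t (partialSum n i) := by
  obtain ⟨j, hj⟩ : ∃ j, blockIndex n t r = j := ⟨_, rfl⟩
  have h1 := blockIndex_le (n := n) (t := t) r
  have h2 := partialSum_blockIndex_le (n := n) (t := t) r
  have h3 := lt_partialSum_of_blockIndex (n := n) (t := t) (r := r)
  rw [hj] at h1 h2 h3
  by_cases hcase : j < t ∧ r + 1 = partialSum n (j + 1)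
  · obtain ⟨hjt, hr⟩ := hcase
    have h5 : X 1 * blockForm K p n t r = X 1 ^ n j * continuant K p n j := by
      rw [blockForm, hj, ← mul_assoc, ← pow_succ']
      congr 2
      rw [partialSum_succ] at hr
      omega
    rw [h5, hr, blockForm_partialSum hn hjt]
    rcases j with _ | j
    · left
      simp [continuant]
    · right
      refine ⟨j, hjt, h2, h3 hjt, ?_⟩
      rw [blockForm_partialSum hn (by omega), continuant]
      ring
  · left
    have h4 : blockIndex n t (r + 1) = j := by
      refine blockIndex_eq h1 (by omega) fun h => ?_
      have := h3 h
      omega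
    rw [blockForm, blockForm, hj, h4, ← mul_assoc, ← pow_succ']
    congr 2
    omega

/-- The ideal generated by the last two of the forms `x ^ p i * g i`. -/
noncomputable def continuantIdeal (K : Type*) [Field K] (p n : ℕ → ℕ) (t : ℕ) :
    Ideal (MvPolynomial (Fin 2) K) :=
  Ideal.span {X 0 ^ p (t - 1) * continuant K p n (t - 1), continuant K p n t}

/-- Multiplied by `x ^ p (j + 1)`, the recursion expresses `x ^ p j * g j` through its two
successors, so membership descends from the two generators. -/
lemma X_pow_mul_continuant_mem (hp : ∀ i, i < t → p (i + 1) < p i) (hpt : p t = 0) (ht : 0 < t)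
    {i : ℕ} (hi : i ≤ t) : X 0 ^ p i * continuant K p n i ∈ continuantIdeal K p n t := by
  have key : ∀ m j, j + 1 + m = t →
      X 0 ^ p j * continuant K p n j ∈ continuantIdeal K p n t ∧
        X 0 ^ p (j + 1) * continuant K p n (j + 1) ∈ continuantIdeal K p n t := by
    intro m
    induction m with
    | zero =>
      intro j hj
      obtain rfl : j = t - 1 := by omega
      have : t - 1 + 1 = t := by omega
      rw [this, hpt, pow_zero, one_mul]
      exact ⟨Ideal.subset_span (by simp), Ideal.subset_span (by simp)⟩
    | succ m ih =>
      intro j hj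
      obtain ⟨h1, h2⟩ := ih (j + 1) (by omega)
      refine ⟨?_, h1⟩
      have e1 := hp j (by omega)
      have e2 : p (j + 2) < p (j + 1) := hp (j + 1) (by omega)
      have : X 0 ^ p j * continuant K p n j =
          X 1 ^ n (j + 1) * (X 0 ^ p (j + 1) * continuant K p n (j + 1)) -
            X 0 ^ (p (j + 1) - p (j + 2)) * (X 0 ^ p (j + 2) * continuant K p n (j + 2)) := by
        have e3 : p j = p (j + 1) + (p j - p (j + 1)) := by omega
        have e4 : (X 0 ^ p j : MvPolynomial (Fin 2) K) =
            X 0 ^ p (j + 1) * X 0 ^ (p j - p (j + 1)) := by rw [← pow_add, ← e3]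
        have e5 : (X 0 ^ (p (j + 1) - p (j + 2)) * X 0 ^ p (j + 2) : MvPolynomial (Fin 2) K) =
            X 0 ^ p (j + 1) := by rw [← pow_add]; congr 1; omega
        rw [← mul_assoc (X 0 ^ (p (j + 1) - p (j + 2))), e5, e4, continuant]
        ring
      rw [this]
      exact Ideal.sub_mem _ (Ideal.mul_mem_left _ _ h1) (Ideal.mul_mem_left _ _ h2)
  rcases Nat.eq_or_lt_of_le hi with rfl | hlt
  · obtain ⟨j, rfl⟩ := Nat.exists_eq_add_of_le' ht
    exact (key 0 j rfl).2
  · exact (key (t - (i + 1)) i (by omega)).1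

/-- `P` has rows of length `p i` in the block `i`, for `i < t`, and no further rows. -/
structure HasBlocks (P : YoungDiagram) (p n : ℕ → ℕ) (t : ℕ) : Prop where
  mem_iff : ∀ i r c, i < t → partialSum n i ≤ r → r < partialSum n (i + 1) →
    ((r, c) ∈ P ↔ c < p i)
  notMem : ∀ r c, partialSum n t ≤ r → (r, c) ∉ P

variable {P : YoungDiagram}

lemma HasBlocks.X_pow_mul_blockForm_mem (hP : HasBlocks P p n t)
    (hp : ∀ i, i < t → p (i + 1) < p i) (hpt : p t = 0) (ht : 0 < t) {r c : ℕ}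
    (h : (r, c) ∉ P) : X 0 ^ c * blockForm K p n t r ∈ continuantIdeal K p n t := by
  have h1 := blockIndex_le (n := n) (t := t) r
  have h2 := partialSum_blockIndex_le (n := n) (t := t) r
  have hc : p (blockIndex n t r) ≤ c := by
    rcases Nat.eq_or_lt_of_le h1 with h3 | h3
    · rw [h3, hpt]; exact Nat.zero_le _
    · rw [hP.mem_iff _ r c h3 h2 (lt_partialSum_of_blockIndex h3)] at h
      exact not_lt.1 h
  obtain ⟨m, rfl⟩ := Nat.exists_eq_add_of_le hc
  have : X 0 ^ (p (blockIndex n t r) + m) * blockForm K p n t r =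
      (X 0 ^ m * X 1 ^ (r - partialSum n (blockIndex n t r))) *
        (X 0 ^ p (blockIndex n t r) * continuant K p n (blockIndex n t r)) := by
    rw [blockForm]; ring
  rw [this]
  exact Ideal.mul_mem_left _ _ (X_pow_mul_continuant_mem hp hpt ht h1)

lemma HasBlocks.mul_mem_span (hP : HasBlocks P p n t)
    (hp : ∀ i, i < t → p (i + 1) < p i) (hn : ∀ i, i < t → 0 < n i)
    (F : MvPolynomial (Fin 2) K) {v : MvPolynomial (Fin 2) K}
    (hv : v ∈ Submodule.span K
      {v | ∃ r c, (r, c) ∉ P ∧ v = X 0 ^ c * blockForm K p n t r}) :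
    F * v ∈ Submodule.span K
      {v | ∃ r c, (r, c) ∉ P ∧ v = X 0 ^ c * blockForm K p n t r} := by
  set J := Submodule.span K {v | ∃ r c, (r, c) ∉ P ∧ v = X 0 ^ c * blockForm K p n t r}
  have hgen : ∀ (i : Fin 2) r c, (r, c) ∉ P → X i * (X 0 ^ c * blockForm K p n t r) ∈ J := by
    intro i r c h
    fin_cases i
    · refine Submodule.subset_span ⟨r, c + 1, fun h' => h (P.up_left_mem le_rfl (by omega) h'), ?_⟩
      simp only [Fin.zero_eta]
      ring
    · have hnext : X 0 ^ c * blockForm K p n t (r + 1) ∈ J :=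
        Submodule.subset_span ⟨r + 1, c, fun h' => h (P.up_left_mem (by omega) le_rfl h'), rfl⟩
      have hcomm : X 1 * (X 0 ^ c * blockForm K p n t r) =
          X 0 ^ c * (X 1 * blockForm K p n t r) := by ring
      simp only [Fin.mk_one]
      rw [hcomm]
      rcases X_mul_blockForm (K := K) (p := p) hn r with h1 | ⟨j, hj, h1, h2, h3⟩
      · rwa [h1]
      · rw [h3, mul_add, ← mul_assoc, ← pow_add]
        refine Submodule.add_mem _ hnext (Submodule.subset_span ⟨_, _, ?_, rfl⟩)
        -- Since `c ≥ p (j + 1)`, the correction term carries `x` to a power at least `p j`, so its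
        -- cell is also outside `P`.
        rw [hP.mem_iff (j + 1) r c hj h1 h2] at h
        have h4 := hn j (by omega)
        have h5 := hp j (by omega)
        rw [hP.mem_iff j _ _ (by omega) le_rfl (by rw [partialSum_succ]; omega)]
        omega
  have hX : ∀ (i : Fin 2) w, w ∈ J → X i * w ∈ J := by
    intro i w hw
    induction hw using Submodule.span_induction with
    | mem w hw =>
      obtain ⟨r, c, h, rfl⟩ := hw
      exact hgen i r c h
    | zero => simp
    | add v w _ _ hv hw => rw [mul_add]; exact Submodule.add_mem _ hv hw
    | smul k v _ hv => rw [mul_smul_comm]; exact Submodule.smul_mem _ _ hv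
  induction F using MvPolynomial.induction_on generalizing v with
  | C a => rw [← smul_eq_C_mul]; exact Submodule.smul_mem _ _ hv
  | add F G hF hG => rw [add_mul]; exact Submodule.add_mem _ (hF hv) (hG hv)
  | mul_X F i hF => rw [mul_assoc]; exact hF (hX i v hv)

lemma HasBlocks.isCIJordanType (hP : HasBlocks P p n t)
    (hp : ∀ i, i < t → p (i + 1) < p i) (hpt : p t = 0) (ht : 0 < t)
    (hn : ∀ i, i < t → 0 < n i)
    (hpn : ∀ i, i + 1 < t → p i = n i + n (i + 1) + p (i + 1)) {T : ℕ → ℕ}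
    (hT : ∀ i, diagonalLength P i = T i) : IsCIJordanType K T P := by
  have hu := isMonicFamily_blockForm (K := K) hp hpn
  have hmem : ∀ r c, (r, c) ∉ P → X 0 ^ c * blockForm K p n t r ∈ continuantIdeal K p n t :=
    fun r c h => hP.X_pow_mul_blockForm_mem hp hpt ht h
  have hlast := hp (t - 1) (by omega)
  have hnlast := hn (t - 1) (by omega)
  have ht1 : t - 1 + 1 = t := by omega
  have hsum : partialSum n t = partialSum n (t - 1) + n (t - 1) := by
    rw [← partialSum_succ, ht1]
  have hspan : ∀ F ∈ continuantIdeal K p n t, F ∈ Submodule.span K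
      {v | ∃ r c, (r, c) ∉ P ∧ v = X 0 ^ c * blockForm K p n t r} := by
    intro F hF
    obtain ⟨α, β, rfl⟩ := Ideal.mem_span_pair.1 hF
    refine Submodule.add_mem _ (hP.mul_mem_span hp hn α (Submodule.subset_span ?_))
      (hP.mul_mem_span hp hn β (Submodule.subset_span ?_))
    · refine ⟨partialSum n (t - 1), p (t - 1), ?_, ?_⟩
      · rw [hP.mem_iff (t - 1) _ _ (by omega) le_rfl (by rw [partialSum_succ]; omega)]
        omega
      · rw [blockForm_partialSum hn (by omega)]
    · refine ⟨partialSum n t, 0, hP.notMem _ _ le_rfl, ?_⟩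
      rw [blockForm_partialSum hn le_rfl, pow_zero, one_mul]
  -- The ideal lies in the span of the basis vectors outside `P`, so the coordinates in `P` vanish
  -- on it.
  have hI : ∀ F ∈ continuantIdeal K p n t, ∀ i ∈ P, hu.basis.repr F i = 0 := by
    intro F hF i hi
    have hle : Submodule.span K {v | ∃ r c, (r, c) ∉ P ∧ v = X 0 ^ c * blockForm K p n t r} ≤
        LinearMap.ker (hu.basis.coord i) := by
      rw [Submodule.span_le]
      rintro _ ⟨r, c, h, rfl⟩
      rw [SetLike.mem_coe, LinearMap.mem_ker, ← hu.basis_apply, hu.basis.coord_apply,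
        hu.basis.repr_self, Finsupp.single_apply, if_neg]
      rintro rfl
      exact h hi
    exact hle (hspan F hF)
  obtain ⟨b, hb⟩ := hu.exists_quotient_basis hmem hI
  have : Finite {c : ℕ × ℕ // c ∈ P} :=
    (Fintype.subtype P.cells fun _ => Iff.rfl : Fintype {c : ℕ × ℕ // c ∈ P}).finite
  refine ⟨continuantIdeal K p n t, X 0, ⟨Module.Finite.of_basis b, _, _,
    p (t - 1) + partialSum n (t - 1), partialSum n t, by omega, by omega, ?_,
    continuant_isHomogeneous hpn t le_rfl, rfl⟩, fun i => ?_, isHomogeneous_X _ _,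
    hasJordanType_of_basis hmem b hb⟩
  · exact (isHomogeneous_X_pow _ _).mul (continuant_isHomogeneous hpn _ (by omega))
  · rw [hu.hilbertFunction_eq hmem b hb, hT]

end Construction

end CIJordan

/-! ### The equivalence. -/

theorem theorem3p9 {K : Type*} [Field K] [Infinite K]
    (d k : ℕ) (hd : 2 ≤ d) (hk : 1 ≤ k)
    (hchar : ringChar K = 0 ∨ 2 * d + k - 3 < ringChar K)
    (P : YoungDiagram)
    (hT : ∀ i, CIJordan.diagonalLength P i = CIJordan.ciSequence d k i)
    (t : ℕ) (p n : Fin t → ℕ) (hP : CIJordan.IsPowerForm P p n) :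
    CIJordan.IsCIJordanType K (CIJordan.ciSequence d k) P ↔
      ∀ (i : ℕ) (hi : i + 1 < t),
        p ⟨i, Nat.lt_of_succ_lt hi⟩ =
          n ⟨i, Nat.lt_of_succ_lt hi⟩ + n ⟨i + 1, hi⟩ + p ⟨i + 1, hi⟩ := by
  have hext : ∀ (q : Fin t → ℕ) i (hi : i < t), CIJordan.extendZero q i = q ⟨i, hi⟩ :=
    fun q i hi => dif_pos hi
  constructor
  · intro h i hi
    have := h.parts_eq hP hi
    rwa [hext p i (by omega), hext n i (by omega), hext n _ hi, hext p _ hi] at this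
  · intro h
    -- The sequence starts with `1`, so `P` is nonempty.
    have ht : 0 < t := by
      by_contra h0
      obtain rfl : t = 0 := by omega
      have h1 := hT 0
      have h2 : CIJordan.diagonalLength P 0 = 0 := by
        rw [CIJordan.diagonalLength, Finset.card_eq_zero, Finset.filter_eq_empty_iff]
        rintro ⟨r, c⟩ hrc
        exact absurd hrc (hP.notMem (by simp [CIJordan.partialSum]))
      rw [h2, CIJordan.ciSequence] at h1
      omega
    refine CIJordan.HasBlocks.isCIJordanType (p := CIJordan.extendZero p)
      (n := CIJordan.extendZero n) (t := t)
      ⟨fun i r c hi h1 h2 => hP.mem_iff hi h1 h2, fun r c h => hP.notMem h⟩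
      (fun i hi => hP.extendZero_succ_lt hi) (by simp [CIJordan.extendZero]) ht
      (fun i hi => by rw [hext n i hi]; exact hP.2.1 _) (fun i hi => ?_) hT
    rw [hext p i (by omega), hext n i (by omega), hext n _ hi, hext p _ hi]
    exact h i hi
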